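/- **Setting (CPE-B).** There are $n$ base arms $[n]$. Playing $e\in[n]$ yields an independent reward from an unknown $R$-sub-Gaussian distribution ($R>0$) with mean $w(e)$. The learner is given a collection $\mathcal M\subseteq 2^{[n]}$ of nonempty super arms, and $\mathtt{MinW}(M,w)=\min_{e\in M}w(e)$ is the value of $M\in\mathcal M$. The optimal super arm $M_*=\arg\max_{M\in\mathcal M}\mathtt{MinW}(M,w)$ is assumed unique, and $\mathtt{OPT}=\mathtt{MinW}(M_*,w)$. Let $N=\{e\notin M_*: w(e)<\mathtt{OPT}\}$. The gap of a base arm is $\Delta^C_e=w(e)-\max_{M\in\mathcal M,\,M\ne M_*}\mathtt{MinW}(M,w)$ if $e\in M_*$, $\Delta^C_e=\mathtt{OPT}-\max_{M\in\mathcal M:\,e\in M}\mathtt{MinW}(M,w)$ if $e\in N$, and $\Delta^C_e=w(e)-\max_{M\in\mathcal M:\,e\in M}\mathtt{MinW}(M,w)$ otherwise. An algorithm adaptively (possibly with internal randomization) chooses base arms to play, decides when to stop, and then returns a set. It is $\delta$-correct (for $\mathcal M$ and $R$) if, for all $R$-sub-Gaussian reward distributions for which the optimal super arm is unique, it returns that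 super arm with probability at least $1-\delta$. Its sample complexity is the number of samples it uses. **Family.** Let $\mathcal F$ be the family of all instances such that: (i) the rewards of each $e$ are Gaussian with mean $w(e)$ and variance $R^2$; (ii) $M_*$ is unique, the second best super arm (exists and) is unique, and it is disjoint from $M_*$; (iii) each sub-optimal super arm has exactly one base arm with $w(e)<\mathtt{OPT}$, each $e\in N$ lies in exactly one super arm, and no sub-optimal super arm contains an $e\in M_*$ with $w(e)=\mathtt{OPT}$. **Theorem.** (a) The family is rich: for every $n$, $R>0$, disjoint $S,B\subseteq[n]$ and $g:[n]\to\mathbb R$, positive on $S\cup B$, such that $g$ has a unique minimizer on $B$ and $\min_{S}g=\min_{B}g$ (with $S,B\neq\emptyset$), there is an instance in $\mathcal F$ with sub-Gaussian parameter $R$, $M_*=S$, $N=B$ and $\Delta^C_e=g(e)$ for all $e\in S\cup B$. (b) There is a universal constant $c>0$ such that for every instance in $\mathcal F$ and every $\delta\in(0,0.1)$, every $\delta$-correct algorithm has, on this instance, expected sample complexity at least $$c\sum_{e\in M_*\cup N}\frac{R^2}{(\Delta^C_e)^2}\ln\frac1\delta .$$ -/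

import Mathlib

open MeasureTheory ProbabilityTheory
open scoped NNReal ENNReal

namespace CPEB

/-- What the learner is given: a decision class of (nonempty) super arms over the base arms
`Fin n`, and the sub-Gaussian parameter `R > 0`. -/
structure Problem (n : ℕ) where
  superArms : Finset (Finset (Fin n))
  nonempty_of_mem : ∀ M ∈ superArms, M.Nonempty
  R : ℝ≥0
  R_pos : 0 < R

/-- The unknown part of an instance: for each base arm a reward distribution on `ℝ` that is
`R`-sub-Gaussian around its mean. -/
structure Environment {n : ℕ} (P : Problem n) where
  law : Fin n → Measure ℝ
  isProbabilityMeasure_law : ∀ e, IsProbabilityMeasure (law e)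
  subGaussian : ∀ e, HasSubgaussianMGF (fun x : ℝ => x - ∫ y, y ∂(law e)) (P.R ^ 2) (law e)

instance {n : ℕ} {P : Problem n} (E : Environment P) (e : Fin n) :
    IsProbabilityMeasure (E.law e) :=
  E.isProbabilityMeasure_law e

/-- The expected reward vector `w`. -/
noncomputable def Environment.w {n : ℕ} {P : Problem n} (E : Environment P) (e : Fin n) : ℝ :=
  ∫ y, y ∂(E.law e)

/-- The bottleneck value `min_{e ∈ M} v e` of a nonempty super arm
(the value at the empty set plays no role). -/
noncomputable def minW {n : ℕ} (M : Finset (Fin n)) (v : Fin n → ℝ) : ℝ :=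
  if h : M.Nonempty then M.inf' h v else 0

/-- `max_{M ∈ F} minW M v` for a nonempty collection `F`
(the value at the empty collection plays no role). -/
noncomputable def maxMinW {n : ℕ} (F : Finset (Finset (Fin n))) (v : Fin n → ℝ) : ℝ :=
  if h : F.Nonempty then F.sup' h (fun M => minW M v) else 0

/-- `M` is the unique maximizer of the bottleneck value over the decision class `F`. -/
def IsUniqueOptimal {n : ℕ} (F : Finset (Finset (Fin n))) (v : Fin n → ℝ)
    (M : Finset (Fin n)) : Prop :=
  M ∈ F ∧ ∀ M' ∈ F, M' ≠ M → minW M' v < minW M v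

/-- The set `N` of base arms outside the optimal super arm `Ms` with `v e < OPT`. -/
noncomputable def necessary {n : ℕ} (v : Fin n → ℝ) (Ms : Finset (Fin n)) : Finset (Fin n) :=
  Finset.univ.filter (fun e => e ∉ Ms ∧ v e < minW Ms v)

/-- The fixed-confidence gap of the base arm `e`, where `Ms` is the optimal super arm. -/
noncomputable def gap {n : ℕ} (F : Finset (Finset (Fin n))) (v : Fin n → ℝ)
    (Ms : Finset (Fin n)) (e : Fin n) : ℝ :=
  if e ∈ Ms then v e - maxMinW (F.filter (fun M => M ≠ Ms)) v
  else if minW Ms v ≤ v e then v e - maxMinW (F.filter (fun M => e ∈ M)) v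
  else minW Ms v - maxMinW (F.filter (fun M => e ∈ M)) v

/-- A (randomized, adaptive) algorithm. It draws an internal seed. After `t` samples it sees the
seed and the history of the `t` base arms played and the rewards observed; the stopping rule
either continues (`none`) or stops and returns a set of base arms, and if it continues, the
sampling rule chooses the next base arm. -/
structure Algorithm (n : ℕ) where
  Seed : Type
  measurableSpace_Seed : MeasurableSpace Seed
  seedLaw : Measure Seed
  isProbabilityMeasure_seedLaw : IsProbabilityMeasure seedLaw
  sample : (t : ℕ) → Seed → (Fin t → Fin n × ℝ) → Fin n
  measurable_sample : ∀ t,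
    Measurable (fun p : Seed × (Fin t → Fin n × ℝ) => sample t p.1 p.2)
  halt : (t : ℕ) → Seed → (Fin t → Fin n × ℝ) → Option (Finset (Fin n))
  measurableSet_halt : ∀ t o,
    MeasurableSet {p : Seed × (Fin t → Fin n × ℝ) | halt t p.1 p.2 = o}

namespace Algorithm

variable {n : ℕ} (A : Algorithm n)

instance : MeasurableSpace A.Seed := A.measurableSpace_Seed

instance : IsProbabilityMeasure A.seedLaw := A.isProbabilityMeasure_seedLaw

/-- The history of the first `t` plays when the seed is `ω.1` and the reward of base arm `e` at
timestep `t` is `ω.2 t e`; only the reward of the played base arm is observed. (The sampling rule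
is followed formally also after the stopping time; this has no effect on what is defined below.) -/
def history (ω : A.Seed × (ℕ → Fin n → ℝ)) : (t : ℕ) → (Fin t → Fin n × ℝ)
  | 0 => fun i => i.elim0
  | t + 1 =>
    Fin.snoc (α := fun _ => Fin n × ℝ) (history ω t)
      (A.sample t ω.1 (history ω t), ω.2 t (A.sample t ω.1 (history ω t)))

/-- The decision of the stopping rule after `t` samples. -/
def decision (ω : A.Seed × (ℕ → Fin n → ℝ)) (t : ℕ) : Option (Finset (Fin n)) :=
  A.halt t ω.1 (A.history ω t)

/-- The number of samples used (`⊤` if the algorithm never stops). -/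
noncomputable def numSamples (ω : A.Seed × (ℕ → Fin n → ℝ)) : ℕ∞ :=
  ⨅ (t : ℕ) (_ : A.decision ω t ≠ none), (t : ℕ∞)

/-- The algorithm stops and returns `M`. -/
def Returns (ω : A.Seed × (ℕ → Fin n → ℝ)) (M : Finset (Fin n)) : Prop :=
  ∃ t : ℕ, A.decision ω t = some M ∧ ∀ s < t, A.decision ω s = none

/-- The joint law of the seed and the rewards: rewards are independent over timesteps (and of the
seed), and those of base arm `e` have law `E.law e`. -/
noncomputable def prob {P : Problem n} (E : Environment P) :
    Measure (A.Seed × (ℕ → Fin n → ℝ)) :=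
  A.seedLaw.prod (Measure.infinitePi (fun _ : ℕ => Measure.pi E.law))

/-- The expected sample complexity. -/
noncomputable def expectedSamples {P : Problem n} (E : Environment P) : ℝ≥0∞ :=
  ∫⁻ ω, (A.numSamples ω : ℝ≥0∞) ∂(A.prob E)

/-- `A` is `δ`-correct for the problem `P`: under all `R`-sub-Gaussian reward distributions for
which the optimal super arm is unique, it is returned with probability at least `1 - δ`. -/
def IsCorrect (P : Problem n) (δ : ℝ) : Prop :=
  ∀ (E : Environment P) (Ms : Finset (Fin n)), IsUniqueOptimal P.superArms E.w Ms →
    ENNReal.ofReal (1 - δ) ≤ A.prob E {ω | A.Returns ω Ms}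

end Algorithm

/-- The family of hard instances; `Ms` is the optimal super arm. -/
structure IsHard {n : ℕ} {P : Problem n} (E : Environment P) (Ms : Finset (Fin n)) : Prop where
  gaussian : ∀ e, E.law e = gaussianReal (E.w e) (P.R ^ 2)
  optimal : IsUniqueOptimal P.superArms E.w Ms
  /-- The second best super arm is unique and disjoint from `Ms`. -/
  second : ∃ M₂ ∈ P.superArms, Disjoint M₂ Ms ∧
    ∀ M ∈ P.superArms, M ≠ Ms → M ≠ M₂ → minW M E.w < minW M₂ E.w
  /-- A sub-optimal super arm has a single base arm with reward below the optimal value. -/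
  single : ∀ M ∈ P.superArms, M ≠ Ms → ∃! e, e ∈ M ∧ E.w e < minW Ms E.w
  /-- A base arm of `N` lies in exactly one super arm. -/
  owner : ∀ e ∈ necessary E.w Ms, ∃! M, M ∈ P.superArms ∧ e ∈ M
  /-- A sub-optimal super arm contains no bottleneck of `Ms`. -/
  bottleneck : ∀ M ∈ P.superArms, M ≠ Ms → ∀ e ∈ M, e ∈ Ms → minW Ms E.w < E.w e

end CPEB

/-!
The lower bound is a change-of-measure argument. Let `E` be a hard instance with optimal super arm
`Ms`, and let `E'` be a Gaussian environment with reward vector `v` and another optimal super arm. A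
`δ`-correct algorithm returns `Ms` with probability at least `1 - δ` under `E` and at most `δ` under
`E'`. Weighting with the likelihood ratio of the observed rewards turns expectations under `E` into
expectations under `E'`, at fixed times (`lintegral_mul_exp_logLik`) and at the stopping time capped
at `t` (`lintegral_mul_exp_logLik_cappedTime`). Multiply this ratio by `1 / δ` where `Ms` has been
returned: the product `y` has mean at most `2` under `E`. Integrating `log y ≤ y / 2 - 1 + log 2`, and
computing the mean of the log-likelihood ratio by Wald's identity (`neg_sum_le_integral_logLik`), gives
for `t → ∞`

  `(1 - δ) * log (1 / δ) ≤ log 2 + ∑ e, (v e - w e) ^ 2 / (2 * R ^ 2) * 𝔼[plays of e]`,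

which for `δ < 0.1` bounds the sum below by `log (1 / δ) / 2`
(`IsCorrect.log_le_sum_mul_expectedPulls`).

It remains to choose `v` for each base arm `e` of `Ms ∪ N` so that (almost) only the mean of `e`
changes, by an amount of order of its gap. For `e ∈ Ms`, lowering `w e` by twice the gap puts `Ms`
below the second best super arm, which is disjoint from `Ms` and so keeps its value. For `e ∈ N`,
raising `w e` to `OPT` gives the only super arm containing `e` the value `OPT`; the bottlenecks of `Ms`,
which it does not contain, are lowered by `ε` to break ties, and `ε → 0` removes their cost.
Summing over `e` bounds the expected number of samples.

The family is rich because the super arms `S` and `{e}`, for `e ∈ B`, already allow all admissible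
gaps.
-/

open MeasureTheory ProbabilityTheory
open scoped NNReal ENNReal

namespace CPEB

namespace Algorithm

variable {n : ℕ} (A : Algorithm n) {P : Problem n}

/-! ### Histories and decisions -/

/-- The base arm played at timestep `t`. -/
def played (ω : A.Seed × (ℕ → Fin n → ℝ)) (t : ℕ) : Fin n :=
  A.sample t ω.1 (A.history ω t)

/-- What the algorithm knows after `t` samples: the seed and the history. -/
def info (t : ℕ) (ω : A.Seed × (ℕ → Fin n → ℝ)) : A.Seed × (Fin t → Fin n × ℝ) :=
  (ω.1, A.history ω t)

/-- The algorithm does not stop with `t` or fewer samples, so it takes sample number `t`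
(counted from `0`). -/
def Running (t : ℕ) (ω : A.Seed × (ℕ → Fin n → ℝ)) : Prop :=
  ∀ s ≤ t, A.decision ω s = none

instance (E : Environment P) : IsProbabilityMeasure (A.prob E) := by
  unfold prob; infer_instance

lemma history_succ (ω : A.Seed × (ℕ → Fin n → ℝ)) (t : ℕ) :
    A.history ω (t + 1) = Fin.snoc (α := fun _ => Fin n × ℝ) (A.history ω t)
      (A.played ω t, ω.2 t (A.played ω t)) := rfl

lemma measurable_finSnoc {α β : Type*} [MeasurableSpace α] [MeasurableSpace β] {t : ℕ}
    {f : α → Fin t → β} {g : α → β} (hf : Measurable f) (hg : Measurable g) :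
    Measurable fun x => (Fin.snoc (α := fun _ => β) (f x) (g x) : Fin (t + 1) → β) := by
  rw [measurable_pi_iff]
  intro i
  induction i using Fin.lastCases with
  | last => simpa using hg
  | cast i => simpa using (measurable_pi_iff.1 hf) i

lemma measurable_apply_arm {α : Type*} [MeasurableSpace α] {f : α → Fin n → ℝ} {g : α → Fin n}
    (hf : Measurable f) (hg : Measurable g) : Measurable fun x => f x (g x) := by
  have h : Measurable fun p : (Fin n → ℝ) × Fin n => p.1 p.2 :=
    measurable_from_prod_countable_left fun e => measurable_pi_apply e
  exact h.comp (hf.prodMk hg)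

lemma measurable_history (t : ℕ) : Measurable fun ω => A.history ω t := by
  induction t with
  | zero => exact measurable_const
  | succ t ih =>
    have hp : Measurable fun ω => A.sample t ω.1 (A.history ω t) :=
      (A.measurable_sample t).comp (measurable_fst.prodMk ih)
    exact measurable_finSnoc ih
      (hp.prodMk (measurable_apply_arm ((measurable_pi_apply t).comp measurable_snd) hp))

lemma measurable_info (t : ℕ) : Measurable (A.info t) :=
  measurable_fst.prodMk (A.measurable_history t)

lemma measurable_played (t : ℕ) : Measurable fun ω => A.played ω t :=
  (A.measurable_sample t).comp (A.measurable_info t)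

/-- The history up to time `t` only depends on the rewards before time `t`. -/
lemma history_congr (u : A.Seed) {x y : ℕ → Fin n → ℝ} (t : ℕ) (h : ∀ s < t, x s = y s) :
    A.history (u, x) t = A.history (u, y) t := by
  induction t with
  | zero => rfl
  | succ t ih =>
    have ih := ih fun s hs => h s (by omega)
    simp only [history_succ, played, ih, h t (Nat.lt_succ_self t)]

lemma history_castLE (ω : A.Seed × (ℕ → Fin n → ℝ)) {s t : ℕ} (h : s ≤ t) :
    (fun i : Fin s => A.history ω t (Fin.castLE h i)) = A.history ω s := by
  induction t, h using Nat.le_induction with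
  | base => rfl
  | succ t h ih =>
    rw [← ih]
    funext i
    exact Fin.snoc_castSucc (α := fun _ => Fin n × ℝ) _ _ (Fin.castLE h i)

/-- The event, in terms of what is known after `t` samples, that no earlier decision was to
stop. -/
def undecidedBefore (t : ℕ) : Set (A.Seed × (Fin t → Fin n × ℝ)) :=
  {p | ∀ s, ∀ h : s < t, A.halt s p.1 (fun i => p.2 (Fin.castLE h.le i)) = none}

lemma measurableSet_undecidedBefore (t : ℕ) : MeasurableSet (A.undecidedBefore t) := by
  have : A.undecidedBefore t = ⋂ s, ⋂ h : s < t,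
      (fun p : A.Seed × (Fin t → Fin n × ℝ) => (p.1, fun i : Fin s => p.2 (Fin.castLE h.le i))) ⁻¹'
        {p | A.halt s p.1 p.2 = none} := by
    ext p; simp [undecidedBefore]
  rw [this]
  refine MeasurableSet.iInter fun s => MeasurableSet.iInter fun h =>
    measurableSet_preimage ?_ (A.measurableSet_halt s none)
  exact measurable_fst.prodMk (measurable_pi_lambda _ fun i =>
    (measurable_pi_apply _).comp measurable_snd)

lemma info_mem_undecidedBefore {t : ℕ} {ω : A.Seed × (ℕ → Fin n → ℝ)} :
    A.info t ω ∈ A.undecidedBefore t ↔ ∀ s < t, A.decision ω s = none := by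
  refine forall_congr' fun s => forall_congr' fun h => ?_
  change A.halt s ω.1 (fun i => A.history ω t (Fin.castLE h.le i)) = none ↔ _
  rw [A.history_castLE ω h.le]
  rfl

/-- The event `Running t` in terms of what is known after `t` samples. -/
def undecidedUpTo (t : ℕ) : Set (A.Seed × (Fin t → Fin n × ℝ)) :=
  A.undecidedBefore t ∩ {p | A.halt t p.1 p.2 = none}

lemma measurableSet_undecidedUpTo (t : ℕ) : MeasurableSet (A.undecidedUpTo t) :=
  (A.measurableSet_undecidedBefore t).inter (A.measurableSet_halt t none)

lemma running_iff {t : ℕ} {ω : A.Seed × (ℕ → Fin n → ℝ)} :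
    A.Running t ω ↔ A.info t ω ∈ A.undecidedUpTo t := by
  rw [undecidedUpTo, Set.mem_inter_iff, info_mem_undecidedBefore]
  constructor
  · exact fun h => ⟨fun s hs => h s hs.le, h t le_rfl⟩
  · rintro ⟨h1, h2⟩ s hs
    rcases hs.lt_or_eq with hs | rfl
    · exact h1 s hs
    · exact h2

lemma measurableSet_running (t : ℕ) : MeasurableSet {ω | A.Running t ω} := by
  simp_rw [running_iff]
  exact A.measurable_info t (A.measurableSet_undecidedUpTo t)

lemma measurableSet_decision (t : ℕ) (o : Option (Finset (Fin n))) :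
    MeasurableSet {ω | A.decision ω t = o} :=
  A.measurable_info t (A.measurableSet_halt t o)

lemma measurableSet_returns (M : Finset (Fin n)) : MeasurableSet {ω | A.Returns ω M} := by
  have : {ω | A.Returns ω M} = ⋃ t, ({ω | A.decision ω t = some M} ∩
      A.info t ⁻¹' A.undecidedBefore t) := by
    ext ω; simp [Returns, info_mem_undecidedBefore]
  rw [this]
  exact MeasurableSet.iUnion fun t => (A.measurableSet_decision t _).inter
    (A.measurable_info t (A.measurableSet_undecidedBefore t))

lemma Returns.unique {ω : A.Seed × (ℕ → Fin n → ℝ)} {M M' : Finset (Fin n)}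
    (h : A.Returns ω M) (h' : A.Returns ω M') : M = M' := by
  obtain ⟨t, ht, hlt⟩ := h
  obtain ⟨t', ht', hlt'⟩ := h'
  have : t = t' := by
    rcases lt_trichotomy t t' with h | h | h
    · simp [hlt' t h] at ht
    · exact h
    · simp [hlt t' h] at ht'
  subst this
  simpa [ht] using ht'

/-! ### Independence of new rewards from the past -/

/-- The rewards at time `t` are independent of what is known after `t` samples. -/
lemma indepFun_info_reward (E : Environment P) (t : ℕ) :
    IndepFun (A.info t) (fun ω => ω.2 t) (A.prob E) := by
  classical
  set μ : Measure (ℕ → Fin n → ℝ) := Measure.infinitePi (fun _ : ℕ => Measure.pi E.law) with hμ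
  have hi : iIndepFun (fun (s : ℕ) (x : ℕ → Fin n → ℝ) => x s) μ :=
    iIndepFun_infinitePi (X := fun _ y => y) fun _ => measurable_id
  have h0 := hi.indepFun_finset (Finset.range t) {t} (by simp) fun s => measurable_pi_apply s
  -- extend the first `t` rewards by zero to express the history through them
  let pad : ((i : Finset.range t) → Fin n → ℝ) → ℕ → Fin n → ℝ :=
    fun y s => if h : s ∈ Finset.range t then y ⟨s, h⟩ else 0
  have hpad : Measurable pad := by
    refine measurable_pi_lambda _ fun s => ?_
    by_cases h : s ∈ Finset.range t
    · simp only [pad, dif_pos h]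
      exact measurable_pi_apply _
    · simp only [pad, dif_neg h]
      exact measurable_const
  have h1 : IndepFun (fun x : ℕ → Fin n → ℝ => pad fun i => x i) (fun x => x t) μ :=
    h0.comp hpad (measurable_pi_apply (⟨t, by simp⟩ : ({t} : Finset ℕ)))
  have hrew : Measurable fun ω : A.Seed × (ℕ → Fin n → ℝ) => ω.2 t :=
    (measurable_pi_apply t).comp measurable_snd
  rw [indepFun_iff_measure_inter_preimage_eq_mul]
  intro S T hS hT
  have hS' := A.measurable_info t hS
  have hT' := hrew hT
  have hmarg : A.prob E ((fun ω => ω.2 t) ⁻¹' T) = μ ((fun x => x t) ⁻¹' T) := by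
    have := Measure.prod_prod (μ := A.seedLaw) (ν := μ) Set.univ ((fun x => x t) ⁻¹' T)
    rw [measure_univ, one_mul] at this
    rw [← this]
    congr 1
    ext ω; simp
  have hfib (u : A.Seed) : (fun x => (u, x)) ⁻¹' (A.info t ⁻¹' S) =
      (fun x : ℕ → Fin n → ℝ => pad fun i => x i) ⁻¹' {y | A.info t (u, y) ∈ S} := by
    ext x
    have : A.history (u, x) t = A.history (u, pad fun i => x i) t :=
      A.history_congr u t fun s hs => by simp [pad, hs]
    simp [info, this]
  rw [hmarg, prob, Measure.prod_apply (hS'.inter hT'), Measure.prod_apply hS',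
    ← lintegral_mul_const _ (measurable_measure_prodMk_left hS')]
  refine lintegral_congr fun u => ?_
  rw [Set.preimage_inter, hfib]
  exact h1.measure_inter_preimage_eq_mul _ _
    (measurable_prodMk_left (A.measurable_info t hS)) hT

lemma map_reward (E : Environment P) (t : ℕ) :
    (A.prob E).map (fun ω => ω.2 t) = Measure.pi E.law := by
  have : (fun ω : A.Seed × (ℕ → Fin n → ℝ) => ω.2 t) = (fun x => x t) ∘ Prod.snd := rfl
  rw [this, ← Measure.map_map (measurable_pi_apply t) measurable_snd, prob, Measure.map_snd_prod,
    measure_univ, one_smul, Measure.infinitePi_map_eval]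

/-- Conditionally on what is known after `t` samples, the rewards at time `t` have law `E.law`. -/
lemma lintegral_info_reward (E : Environment P) (t : ℕ)
    {F : (A.Seed × (Fin t → Fin n × ℝ)) × (Fin n → ℝ) → ℝ≥0∞} (hF : Measurable F) :
    ∫⁻ ω, F (A.info t ω, ω.2 t) ∂A.prob E =
      ∫⁻ ω, ∫⁻ y, F (A.info t ω, y) ∂Measure.pi E.law ∂A.prob E := by
  have hrew : Measurable fun ω : A.Seed × (ℕ → Fin n → ℝ) => ω.2 t :=
    (measurable_pi_apply t).comp measurable_snd
  have h := (indepFun_iff_map_prod_eq_prod_map_map (A.measurable_info t).aemeasurable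
    hrew.aemeasurable).1 (A.indepFun_info_reward E t)
  rw [map_reward] at h
  rw [← lintegral_map (f := F) hF ((A.measurable_info t).prodMk hrew), h,
    lintegral_prod _ hF.aemeasurable,
    lintegral_map hF.lintegral_prod_right' (A.measurable_info t)]

/-! ### Likelihood ratios -/

/-- The log-likelihood ratio of a history, given the log-likelihood ratio `ℓ e x` of a reward `x`
of base arm `e`. -/
def logLik (ℓ : Fin n → ℝ → ℝ) {t : ℕ} (h : Fin t → Fin n × ℝ) : ℝ :=
  ∑ i, ℓ (h i).1 (h i).2

lemma measurable_uncurry_arm {ℓ : Fin n → ℝ → ℝ} (hℓ : ∀ e, Measurable (ℓ e)) :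
    Measurable fun p : Fin n × ℝ => ℓ p.1 p.2 :=
  measurable_from_prod_countable_right hℓ

lemma measurable_logLik {ℓ : Fin n → ℝ → ℝ} (hℓ : ∀ e, Measurable (ℓ e)) (t : ℕ) :
    Measurable fun h : Fin t → Fin n × ℝ => logLik ℓ h :=
  Finset.measurable_sum _ fun i _ => (measurable_uncurry_arm hℓ).comp (measurable_pi_apply i)

lemma logLik_snoc (ℓ : Fin n → ℝ → ℝ) {t : ℕ} (h : Fin t → Fin n × ℝ) (p : Fin n × ℝ) :
    logLik ℓ (Fin.snoc (α := fun _ => Fin n × ℝ) h p : Fin (t + 1) → Fin n × ℝ) =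
      logLik ℓ h + ℓ p.1 p.2 := by
  simp [logLik, Fin.sum_univ_castSucc]

lemma logLik_history (ℓ : Fin n → ℝ → ℝ) (ω : A.Seed × (ℕ → Fin n → ℝ)) (t : ℕ) :
    logLik ℓ (A.history ω t) =
      ∑ s ∈ Finset.range t, ℓ (A.played ω s) (ω.2 s (A.played ω s)) := by
  induction t with
  | zero => simp [logLik]
  | succ t ih => rw [history_succ, logLik_snoc, ih, Finset.sum_range_succ]

lemma lintegral_pi_law (E : Environment P) (e : Fin n) {f : ℝ → ℝ≥0∞} (hf : Measurable f) :
    ∫⁻ y, f (y e) ∂Measure.pi E.law = ∫⁻ x, f x ∂E.law e := by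
  have h := (measurePreserving_eval E.law e).map_eq
  rw [← h, lintegral_map hf (measurable_pi_apply e)]

/-- Change of measure at a fixed time: expectations under `E'` of functions of what is known
after `t` samples are expectations under `E` weighted with the likelihood ratio. -/
lemma lintegral_mul_exp_logLik (E E' : Environment P) {ℓ : Fin n → ℝ → ℝ}
    (hℓ : ∀ e, Measurable (ℓ e))
    (hE : ∀ e, E'.law e = (E.law e).withDensity fun x => ENNReal.ofReal (Real.exp (ℓ e x)))
    (t : ℕ) {f : A.Seed × (Fin t → Fin n × ℝ) → ℝ≥0∞} (hf : Measurable f) :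
    ∫⁻ ω, f (A.info t ω) * ENNReal.ofReal (Real.exp (logLik ℓ (A.history ω t))) ∂A.prob E =
      ∫⁻ ω, f (A.info t ω) ∂A.prob E' := by
  induction t with
  | zero =>
    have h0 (F : Environment P) : ∫⁻ ω, f (A.info 0 ω) ∂A.prob F =
        ∫⁻ u, f (u, fun i => i.elim0) ∂A.seedLaw := by
      rw [prob, lintegral_prod (fun ω => f (A.info 0 ω))
        (hf.comp (A.measurable_info 0)).aemeasurable]
      refine lintegral_congr fun u => ?_
      simp [info, history]
    simp only [logLik, Finset.univ_eq_empty, Finset.sum_empty, Real.exp_zero, ENNReal.ofReal_one,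
      mul_one, h0]
  | succ t ih =>
    -- the function of the new information, split into the old information and the new rewards
    let f₁ : (A.Seed × (Fin t → Fin n × ℝ)) × (Fin n → ℝ) → ℝ≥0∞ := fun q =>
      f (q.1.1, Fin.snoc (α := fun _ => Fin n × ℝ) q.1.2
        (A.sample t q.1.1 q.1.2, q.2 (A.sample t q.1.1 q.1.2)))
    have hs : Measurable fun q : (A.Seed × (Fin t → Fin n × ℝ)) × (Fin n → ℝ) =>
        A.sample t q.1.1 q.1.2 := (A.measurable_sample t).comp measurable_fst
    have hx := measurable_apply_arm measurable_snd hs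
    have hf₁ : Measurable f₁ := hf.comp ((measurable_fst.comp measurable_fst).prodMk
      (measurable_finSnoc (measurable_snd.comp measurable_fst) (hs.prodMk hx)))
    let r : (A.Seed × (Fin t → Fin n × ℝ)) × (Fin n → ℝ) → ℝ≥0∞ := fun q =>
      ENNReal.ofReal (Real.exp (ℓ (A.sample t q.1.1 q.1.2) (q.2 (A.sample t q.1.1 q.1.2))))
    have hr : Measurable r := ENNReal.measurable_ofReal.comp
      (Real.measurable_exp.comp ((measurable_uncurry_arm hℓ).comp (hs.prodMk hx)))
    let Z : (A.Seed × (Fin t → Fin n × ℝ)) → ℝ≥0∞ := fun p =>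
      ENNReal.ofReal (Real.exp (logLik ℓ p.2))
    have hZ : Measurable Z := ENNReal.measurable_ofReal.comp
      (Real.measurable_exp.comp ((measurable_logLik hℓ t).comp measurable_snd))
    have hkey (p : A.Seed × (Fin t → Fin n × ℝ)) :
        ∫⁻ y, f₁ (p, y) * r (p, y) ∂Measure.pi E.law = ∫⁻ y, f₁ (p, y) ∂Measure.pi E'.law := by
      set a := A.sample t p.1 p.2 with ha
      have hg : Measurable fun x : ℝ =>
          f (p.1, Fin.snoc (α := fun _ => Fin n × ℝ) p.2 (a, x)) :=
        hf.comp (measurable_const.prodMk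
          (measurable_finSnoc measurable_const (measurable_const.prodMk measurable_id)))
      have hd : Measurable fun x : ℝ => ENNReal.ofReal (Real.exp (ℓ a x)) :=
        ENNReal.measurable_ofReal.comp (Real.measurable_exp.comp (hℓ a))
      rw [show ∫⁻ y, f₁ (p, y) ∂Measure.pi E'.law = _ from lintegral_pi_law E' a hg, hE,
        lintegral_withDensity_eq_lintegral_mul _ hd hg]
      refine (lintegral_pi_law E a (hg.mul hd)).trans ?_
      exact lintegral_congr fun x => mul_comm _ _
    calc ∫⁻ ω, f (A.info (t + 1) ω) *
          ENNReal.ofReal (Real.exp (logLik ℓ (A.history ω (t + 1)))) ∂A.prob E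
        = ∫⁻ ω, Z (A.info t ω) * (f₁ (A.info t ω, ω.2 t) * r (A.info t ω, ω.2 t)) ∂A.prob E := by
          refine lintegral_congr fun ω => ?_
          rw [history_succ, logLik_snoc, Real.exp_add, ENNReal.ofReal_mul (Real.exp_pos _).le,
            mul_left_comm]
          rfl
      _ = ∫⁻ ω, ∫⁻ y, Z (A.info t ω) * (f₁ (A.info t ω, y) * r (A.info t ω, y))
            ∂Measure.pi E.law ∂A.prob E :=
          A.lintegral_info_reward E t
            (F := fun q => Z q.1 * (f₁ q * r q)) ((hZ.comp measurable_fst).mul (hf₁.mul hr))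
      _ = ∫⁻ ω, (∫⁻ y, f₁ (A.info t ω, y) ∂Measure.pi E'.law) * Z (A.info t ω) ∂A.prob E := by
          refine lintegral_congr fun ω => ?_
          have hm : Measurable fun y => f₁ (A.info t ω, y) * r (A.info t ω, y) :=
            (hf₁.mul hr).comp measurable_prodMk_left
          rw [lintegral_const_mul _ hm, hkey, mul_comm]
      _ = ∫⁻ ω, ∫⁻ y, f₁ (A.info t ω, y) ∂Measure.pi E'.law ∂A.prob E' :=
          ih (f := fun p => ∫⁻ y, f₁ (p, y) ∂Measure.pi E'.law) hf₁.lintegral_prod_right'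
      _ = ∫⁻ ω, f (A.info (t + 1) ω) ∂A.prob E' := (A.lintegral_info_reward E' t hf₁).symm

/-! ### The capped stopping time -/

/-- The number of samples used, capped at `t`. -/
noncomputable def cappedTime (t : ℕ) (ω : A.Seed × (ℕ → Fin n → ℝ)) : ℕ :=
  open Classical in
  Nat.find (p := fun s => t ≤ s ∨ A.decision ω s ≠ none) ⟨t, Or.inl le_rfl⟩

lemma cappedTime_le (t : ℕ) (ω : A.Seed × (ℕ → Fin n → ℝ)) : A.cappedTime t ω ≤ t := by
  classical
  exact Nat.find_min' _ (Or.inl le_rfl)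

lemma lt_cappedTime_iff {s t : ℕ} {ω : A.Seed × (ℕ → Fin n → ℝ)} :
    s < A.cappedTime t ω ↔ s < t ∧ A.Running s ω := by
  classical
  rw [cappedTime, Nat.lt_find_iff]
  simp only [not_or, not_le, not_not, Running]
  exact ⟨fun h => ⟨(h s le_rfl).1, fun r hr => (h r hr).2⟩,
    fun h r hr => ⟨hr.trans_lt h.1, h.2 r hr⟩⟩

lemma cappedTime_eq_iff {s t : ℕ} (hs : s ≤ t) {ω : A.Seed × (ℕ → Fin n → ℝ)} :
    A.cappedTime t ω = s ↔
      A.info s ω ∈ A.undecidedBefore s ∩ {p | t ≤ s ∨ A.halt s p.1 p.2 ≠ none} := by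
  classical
  rw [cappedTime, Nat.find_eq_iff, Set.mem_inter_iff, info_mem_undecidedBefore, and_comm]
  refine and_congr ⟨fun h r hr => ?_, fun h r hr => ?_⟩ Iff.rfl
  · simpa using (not_or.1 (h r hr)).2
  · simp [h r hr, hr.trans_le hs]

lemma measurableSet_cappedTime_eq {s t : ℕ} (hs : s ≤ t) :
    ∃ S : Set (A.Seed × (Fin s → Fin n × ℝ)), MeasurableSet S ∧
      ∀ ω, A.cappedTime t ω = s ↔ A.info s ω ∈ S := by
  refine ⟨_, (A.measurableSet_undecidedBefore s).inter ?_, fun ω => A.cappedTime_eq_iff hs⟩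
  by_cases h : t ≤ s
  · simp [h]
  · simp only [h, false_or]
    exact (A.measurableSet_halt s none).compl

lemma decision_cappedTime_eq_some {t : ℕ} {ω : A.Seed × (ℕ → Fin n → ℝ)} {M : Finset (Fin n)} :
    A.decision ω (A.cappedTime t ω) = some M ↔
      ∃ s ≤ t, A.decision ω s = some M ∧ ∀ r < s, A.decision ω r = none := by
  constructor
  · exact fun h => ⟨_, A.cappedTime_le t ω, h, fun r hr => ((A.lt_cappedTime_iff).1 hr).2 r le_rfl⟩
  · rintro ⟨s, hs, hM, hlt⟩
    have : A.cappedTime t ω = s := by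
      rw [cappedTime_eq_iff A hs, Set.mem_inter_iff, info_mem_undecidedBefore]
      refine ⟨hlt, Or.inr ?_⟩
      change A.decision ω s ≠ none
      simp [hM]
    rw [this, hM]

/-- An integral of a family of functions evaluated at the capped stopping time splits according
to the value of that time. -/
lemma lintegral_cappedTime (μ : Measure (A.Seed × (ℕ → Fin n → ℝ))) (t : ℕ)
    {F : ℕ → A.Seed × (ℕ → Fin n → ℝ) → ℝ≥0∞} (hF : ∀ s, Measurable (F s)) :
    ∫⁻ ω, F (A.cappedTime t ω) ω ∂μ =
      ∑ s ∈ Finset.range (t + 1), ∫⁻ ω, {ω | A.cappedTime t ω = s}.indicator (F s) ω ∂μ := by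
  classical
  have hm : ∀ s ∈ Finset.range (t + 1), Measurable ({ω | A.cappedTime t ω = s}.indicator (F s)) := by
    intro s hs
    obtain ⟨S, hS, h⟩ := A.measurableSet_cappedTime_eq (Finset.mem_range_succ_iff.1 hs)
    simp_rw [h]
    exact (hF s).indicator (A.measurable_info s hS)
  rw [← lintegral_finsetSum _ hm]
  refine lintegral_congr fun ω => ?_
  simp only [Set.indicator_apply, Set.mem_ofPred_eq]
  rw [Finset.sum_ite_eq, if_pos (Finset.mem_range_succ_iff.2 (A.cappedTime_le t ω))]

/-- Change of measure at the capped stopping time. -/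
lemma lintegral_mul_exp_logLik_cappedTime (E E' : Environment P) {ℓ : Fin n → ℝ → ℝ}
    (hℓ : ∀ e, Measurable (ℓ e))
    (hE : ∀ e, E'.law e = (E.law e).withDensity fun x => ENNReal.ofReal (Real.exp (ℓ e x)))
    (t : ℕ) {G : (s : ℕ) → A.Seed × (Fin s → Fin n × ℝ) → ℝ≥0∞} (hG : ∀ s, Measurable (G s)) :
    ∫⁻ ω, G (A.cappedTime t ω) (A.info (A.cappedTime t ω) ω) *
        ENNReal.ofReal (Real.exp (logLik ℓ (A.history ω (A.cappedTime t ω)))) ∂A.prob E =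
      ∫⁻ ω, G (A.cappedTime t ω) (A.info (A.cappedTime t ω) ω) ∂A.prob E' := by
  rw [A.lintegral_cappedTime (A.prob E) t
      (F := fun s ω => G s (A.info s ω) * ENNReal.ofReal (Real.exp (logLik ℓ (A.history ω s))))
      (fun s => ((hG s).comp (A.measurable_info s)).mul (ENNReal.measurable_ofReal.comp
        (Real.measurable_exp.comp ((measurable_logLik hℓ s).comp (A.measurable_history s))))),
    A.lintegral_cappedTime (A.prob E') t (F := fun s ω => G s (A.info s ω))
      (fun s => (hG s).comp (A.measurable_info s))]
  refine Finset.sum_congr rfl fun s hs => ?_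
  obtain ⟨S, hS, h⟩ := A.measurableSet_cappedTime_eq (Finset.mem_range_succ_iff.1 hs)
  have key := A.lintegral_mul_exp_logLik E E' hℓ hE s ((hG s).indicator hS)
  simp_rw [h]
  refine Eq.trans (lintegral_congr fun ω => ?_) (key.trans (lintegral_congr fun ω => ?_)) <;>
  by_cases hω : A.info s ω ∈ S <;> simp [hω]

/-! ### Expected numbers of plays -/

/-- The event that sample number `t` is taken, and is a play of the base arm `e`. -/
def pullEvent (e : Fin n) (t : ℕ) : Set (A.Seed × (ℕ → Fin n → ℝ)) :=
  {ω | A.Running t ω ∧ A.played ω t = e}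

lemma measurableSet_pullEvent (e : Fin n) (t : ℕ) : MeasurableSet (A.pullEvent e t) :=
  (A.measurableSet_running t).inter (A.measurable_played t (measurableSet_singleton e))

/-- The expected number of plays of the base arm `e` before stopping. -/
noncomputable def expectedPulls (E : Environment P) (e : Fin n) : ℝ≥0∞ :=
  ∑' t, A.prob E (A.pullEvent e t)

lemma tsum_running_le_numSamples (ω : A.Seed × (ℕ → Fin n → ℝ)) :
    ∑' t, {ω | A.Running t ω}.indicator (1 : A.Seed × (ℕ → Fin n → ℝ) → ℝ≥0∞) ω ≤ (A.numSamples ω : ℝ≥0∞) := by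
  classical
  rw [numSamples, ENat.toENNReal_iInf]
  refine le_iInf fun t => ?_
  rw [ENat.toENNReal_iInf]
  refine le_iInf fun ht => ?_
  have hout : ∀ s ∉ Finset.range t,
      {ω | A.Running s ω}.indicator (1 : A.Seed × (ℕ → Fin n → ℝ) → ℝ≥0∞) ω = 0 := by
    intro s hs
    refine Set.indicator_of_notMem (fun h : A.Running s ω => ht (h t ?_)) _
    simpa using hs
  rw [ENat.toENNReal_coe, tsum_eq_sum hout]
  calc _ ≤ ∑ s ∈ Finset.range t, (1 : ℝ≥0∞) :=
        Finset.sum_le_sum fun s _ => by rw [Set.indicator_apply]; split_ifs <;> simp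
    _ = t := by simp

lemma sum_expectedPulls_le (E : Environment P) :
    ∑ e, A.expectedPulls E e ≤ A.expectedSamples E := by
  unfold expectedPulls
  rw [← Summable.tsum_finsetSum fun e _ => ENNReal.summable]
  have h (t : ℕ) : ∑ e, A.prob E (A.pullEvent e t) = A.prob E {ω | A.Running t ω} := by
    rw [← measure_biUnion_finset _ fun e _ => A.measurableSet_pullEvent e t]
    · congr 1
      ext ω
      simp [pullEvent]
    · intro e _ e' _ hne
      exact Set.disjoint_left.2 fun ω h h' => hne (h.2.symm.trans h'.2)
  simp_rw [h]
  calc ∑' t, A.prob E {ω | A.Running t ω}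
      = ∫⁻ ω, ∑' t, {ω | A.Running t ω}.indicator (1 : A.Seed × (ℕ → Fin n → ℝ) → ℝ≥0∞) ω ∂A.prob E := by
        rw [lintegral_tsum fun t =>
          (measurable_one.indicator (A.measurableSet_running t)).aemeasurable]
        simp_rw [lintegral_indicator_one (A.measurableSet_running _)]
    _ ≤ A.expectedSamples E := lintegral_mono A.tsum_running_le_numSamples

section Reward

variable (E : Environment P) {ℓ : ℝ → ℝ} {e : Fin n}

lemma map_reward_arm (t : ℕ) :
    (A.prob E).map (fun ω => ω.2 t e) = E.law e := by
  have hm : Measurable fun ω : A.Seed × (ℕ → Fin n → ℝ) => ω.2 t :=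
    (measurable_pi_apply t).comp measurable_snd
  rw [show (fun ω : A.Seed × (ℕ → Fin n → ℝ) => ω.2 t e) = (fun y => y e) ∘ fun ω => ω.2 t from rfl,
    ← Measure.map_map (measurable_pi_apply e) hm, map_reward]
  exact (measurePreserving_eval E.law e).map_eq

lemma measurable_reward_arm (t : ℕ) :
    Measurable fun ω : A.Seed × (ℕ → Fin n → ℝ) => ω.2 t e :=
  (measurable_pi_apply e).comp ((measurable_pi_apply t).comp measurable_snd)

lemma integrable_reward (hi : Integrable ℓ (E.law e)) (t : ℕ) :
    Integrable (fun ω => ℓ (ω.2 t e)) (A.prob E) := by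
  rw [← A.map_reward_arm E t] at hi
  exact hi.comp_measurable (A.measurable_reward_arm t)

/-- The decision to play `e` at time `t` is independent of the reward of `e` at that time. -/
lemma integral_pullEvent_reward (hm : Measurable ℓ) (t : ℕ) :
    ∫ ω, (A.pullEvent e t).indicator (fun ω => ℓ (ω.2 t e)) ω ∂A.prob E =
      (A.prob E).real (A.pullEvent e t) * ∫ x, ℓ x ∂E.law e := by
  let S : Set (A.Seed × (Fin t → Fin n × ℝ)) :=
    A.undecidedUpTo t ∩ {p | A.sample t p.1 p.2 = e}
  have hS : MeasurableSet S := (A.measurableSet_undecidedUpTo t).inter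
    (A.measurable_sample t (measurableSet_singleton e))
  have hpe : A.pullEvent e t = A.info t ⁻¹' S := by
    ext ω
    simp only [pullEvent, running_iff, S]
    rfl
  have hind := (A.indepFun_info_reward E t).comp
    (measurable_one.indicator hS : Measurable (S.indicator (1 : A.Seed × (Fin t → Fin n × ℝ) → ℝ)))
    (hm.comp (measurable_pi_apply e))
  have h1 : Measurable (S.indicator (1 : A.Seed × (Fin t → Fin n × ℝ) → ℝ) ∘ A.info t) :=
    (measurable_one.indicator hS).comp (A.measurable_info t)
  have h2 : Measurable ((ℓ ∘ fun y : Fin n → ℝ => y e) ∘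
      fun ω : A.Seed × (ℕ → Fin n → ℝ) => ω.2 t) := hm.comp (A.measurable_reward_arm t)
  have h := hind.integral_fun_mul_eq_mul_integral h1.aestronglyMeasurable h2.aestronglyMeasurable
  have e1 : ∫ ω, (S.indicator (1 : A.Seed × (Fin t → Fin n × ℝ) → ℝ) ∘ A.info t) ω ∂A.prob E =
      (A.prob E).real (A.pullEvent e t) := by
    rw [← integral_indicator_one (A.measurableSet_pullEvent e t), hpe]
    rfl
  have e2 : ∫ ω, ((ℓ ∘ fun y : Fin n → ℝ => y e) ∘
      fun ω : A.Seed × (ℕ → Fin n → ℝ) => ω.2 t) ω ∂A.prob E = ∫ x, ℓ x ∂E.law e := by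
    rw [← A.map_reward_arm E t, integral_map (A.measurable_reward_arm t).aemeasurable
      hm.aestronglyMeasurable]
    rfl
  rw [e1, e2] at h
  rw [← h]
  refine integral_congr_ae (Filter.Eventually.of_forall fun ω => ?_)
  rw [hpe]
  by_cases hω : A.info t ω ∈ S <;> simp [hω]

end Reward

/-! ### The information inequality -/

/-- At the capped stopping time, the log-likelihood ratio is a sum over base arms and plays. -/
lemma logLik_cappedTime (ℓ : Fin n → ℝ → ℝ) (t : ℕ) (ω : A.Seed × (ℕ → Fin n → ℝ)) :
    logLik ℓ (A.history ω (A.cappedTime t ω)) = ∑ s ∈ Finset.range t, ∑ e,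
      (A.pullEvent e s).indicator (fun ω => ℓ e (ω.2 s e)) ω := by
  classical
  rw [logLik_history]
  have hsub : Finset.range (A.cappedTime t ω) = (Finset.range t).filter (fun s => A.Running s ω) := by
    ext s
    simp [lt_cappedTime_iff]
  rw [hsub, Finset.sum_filter]
  refine Finset.sum_congr rfl fun s _ => ?_
  simp only [Set.indicator_apply, pullEvent, Set.mem_ofPred_eq]
  by_cases h : A.Running s ω <;> simp [h]

section Information

variable (E E' : Environment P) {ℓ : Fin n → ℝ → ℝ} {κ : Fin n → ℝ}

lemma integrable_logLik_cappedTime (hi : ∀ e, Integrable (ℓ e) (E.law e)) (t : ℕ) :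
    Integrable (fun ω => logLik ℓ (A.history ω (A.cappedTime t ω))) (A.prob E) := by
  simp_rw [logLik_cappedTime]
  exact integrable_finsetSum _ fun s _ => integrable_finsetSum _ fun e _ =>
    (A.integrable_reward E (hi e) s).indicator (A.measurableSet_pullEvent e s)

/-- Wald's identity for the log-likelihood ratio, as a bound uniform in the cap. -/
lemma neg_sum_le_integral_logLik (hm : ∀ e, Measurable (ℓ e))
    (hi : ∀ e, Integrable (ℓ e) (E.law e)) (hκ : ∀ e, 0 ≤ κ e)
    (hint : ∀ e, ∫ x, ℓ e x ∂E.law e = -κ e) (hfin : ∀ e, A.expectedPulls E e ≠ ∞) (t : ℕ) :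
    -∑ e, κ e * (A.expectedPulls E e).toReal ≤
      ∫ ω, logLik ℓ (A.history ω (A.cappedTime t ω)) ∂A.prob E := by
  have hI (s : ℕ) (e : Fin n) : Integrable
      ((A.pullEvent e s).indicator fun ω => ℓ e (ω.2 s e)) (A.prob E) :=
    (A.integrable_reward E (hi e) s).indicator (A.measurableSet_pullEvent e s)
  simp_rw [logLik_cappedTime]
  rw [integral_finsetSum _ fun s _ => integrable_finsetSum _ fun e _ => hI s e]
  simp_rw [integral_finsetSum _ fun e _ => hI _ e, A.integral_pullEvent_reward E (hm _), hint]
  rw [Finset.sum_comm, ← Finset.sum_neg_distrib]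
  refine Finset.sum_le_sum fun e _ => ?_
  rw [← Finset.sum_mul]
  have : ∑ s ∈ Finset.range t, (A.prob E).real (A.pullEvent e s) ≤
      (A.expectedPulls E e).toReal := by
    simp only [Measure.real]
    rw [← ENNReal.toReal_sum fun s _ => measure_ne_top _ _]
    exact ENNReal.toReal_mono (hfin e) (ENNReal.sum_le_tsum _)
  nlinarith [hκ e]

/-- The information inequality with the stopping time capped at `t`. It combines
`log y ≤ y / 2 - 1 + log 2` for the likelihood ratio `y`, boosted by the factor `1 / δ` where `M` is
returned, with the fact that this boosted ratio has mean at most `2`. -/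
lemma log_mul_measureReal_le (hm : ∀ e, Measurable (ℓ e))
    (hE : ∀ e, E'.law e = (E.law e).withDensity fun x => ENNReal.ofReal (Real.exp (ℓ e x)))
    (hi : ∀ e, Integrable (ℓ e) (E.law e)) (hκ : ∀ e, 0 ≤ κ e)
    (hint : ∀ e, ∫ x, ℓ e x ∂E.law e = -κ e) (hfin : ∀ e, A.expectedPulls E e ≠ ∞)
    {δ : ℝ} (hδ : 0 < δ) {M : Finset (Fin n)}
    (hM : A.prob E' {ω | A.Returns ω M} ≤ ENNReal.ofReal δ) (t : ℕ) :
    Real.log (1 / δ) * (A.prob E).real {ω | A.decision ω (A.cappedTime t ω) = some M} ≤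
      Real.log 2 + ∑ e, κ e * (A.expectedPulls E e).toReal := by
  classical
  set B : Set (A.Seed × (ℕ → Fin n → ℝ)) := {ω | A.decision ω (A.cappedTime t ω) = some M} with hB
  set L : ℝ := Real.log (1 / δ) with hL
  have hexpL : Real.exp L = 1 / δ := Real.exp_log (by positivity)
  have hBret : B ⊆ {ω | A.Returns ω M} := by
    intro ω hω
    obtain ⟨s, -, h⟩ := (A.decision_cappedTime_eq_some).1 hω
    exact ⟨s, h⟩
  have hBm : MeasurableSet B := by
    have : B = ⋃ s, ⋃ _ : s ≤ t, ({ω | A.decision ω s = some M} ∩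
        A.info s ⁻¹' A.undecidedBefore s) := by
      ext ω
      simp [hB, decision_cappedTime_eq_some, info_mem_undecidedBefore, and_left_comm]
    rw [this]
    exact MeasurableSet.iUnion fun s => MeasurableSet.iUnion fun _ =>
      (A.measurableSet_decision s _).inter (A.measurable_info s (A.measurableSet_undecidedBefore s))
  let Y : A.Seed × (ℕ → Fin n → ℝ) → ℝ := fun ω => logLik ℓ (A.history ω (A.cappedTime t ω))
  have hY : Integrable Y (A.prob E) := A.integrable_logLik_cappedTime E hi t
  let g : A.Seed × (ℕ → Fin n → ℝ) → ℝ := B.indicator fun _ => L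
  have hg : Integrable g (A.prob E) := (integrable_const L).indicator hBm
  let G : (s : ℕ) → A.Seed × (Fin s → Fin n × ℝ) → ℝ≥0∞ := fun s =>
    {p | A.halt s p.1 p.2 = some M}.piecewise (fun _ => ENNReal.ofReal (1 / δ)) fun _ => 1
  have hG (s : ℕ) : Measurable (G s) :=
    measurable_const.piecewise (A.measurableSet_halt s _) measurable_const
  have hGg (ω) : G (A.cappedTime t ω) (A.info (A.cappedTime t ω) ω) =
      ENNReal.ofReal (Real.exp (g ω)) := by
    have hmem : A.info (A.cappedTime t ω) ω ∈
      {p : A.Seed × (Fin (A.cappedTime t ω) → Fin n × ℝ) |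
        A.halt (A.cappedTime t ω) p.1 p.2 = some M} ↔ ω ∈ B := Iff.rfl
    by_cases hω : ω ∈ B
    · refine (Set.piecewise_eq_of_mem _ _ _ (hmem.2 hω)).trans ?_
      simp [g, hω, hexpL]
    · refine (Set.piecewise_eq_of_notMem _ _ _ (mt hmem.1 hω)).trans ?_
      simp [g, hω]
  have hlint : ∫⁻ ω, ENNReal.ofReal (Real.exp (g ω + Y ω)) ∂A.prob E ≤ 2 := by
    have h := A.lintegral_mul_exp_logLik_cappedTime E E' hm hE t hG
    simp_rw [hGg] at h
    calc ∫⁻ ω, ENNReal.ofReal (Real.exp (g ω + Y ω)) ∂A.prob E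
        = ∫⁻ ω, ENNReal.ofReal (Real.exp (g ω)) ∂A.prob E' := by
          rw [← h]
          refine lintegral_congr fun ω => ?_
          rw [Real.exp_add, ENNReal.ofReal_mul (Real.exp_pos _).le]
      _ ≤ ∫⁻ ω, (1 + B.indicator (fun _ => ENNReal.ofReal (1 / δ)) ω) ∂A.prob E' := by
          refine lintegral_mono fun ω => ?_
          by_cases hω : ω ∈ B
          · simp [g, hω, hexpL]
          · simp [g, hω]
      _ = 1 + ENNReal.ofReal (1 / δ) * A.prob E' B := by
          rw [lintegral_add_left measurable_const, lintegral_indicator_const hBm]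
          simp
      _ ≤ 1 + ENNReal.ofReal (1 / δ) * ENNReal.ofReal δ := by
          gcongr
          exact (measure_mono hBret).trans hM
      _ = 2 := by
          rw [← ENNReal.ofReal_mul (by positivity), one_div_mul_cancel hδ.ne', ENNReal.ofReal_one]
          norm_num
  have hexp_meas : AEStronglyMeasurable (fun ω => Real.exp (g ω + Y ω)) (A.prob E) :=
    Real.continuous_exp.comp_aestronglyMeasurable (hg.add hY).aestronglyMeasurable
  have hexp_int : Integrable (fun ω => Real.exp (g ω + Y ω)) (A.prob E) := by
    refine ⟨hexp_meas, ?_⟩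
    rw [hasFiniteIntegral_iff_ofReal (Filter.Eventually.of_forall fun ω => (Real.exp_pos _).le)]
    exact hlint.trans_lt (by simp)
  have hexp_le : ∫ ω, Real.exp (g ω + Y ω) ∂A.prob E ≤ 2 := by
    rw [integral_eq_lintegral_of_nonneg_ae
      (Filter.Eventually.of_forall fun ω => (Real.exp_pos _).le) hexp_meas]
    simpa using ENNReal.toReal_mono (by simp) hlint
  have hpt (ω) : g ω + Y ω ≤ Real.exp (g ω + Y ω) / 2 + (Real.log 2 - 1) := by
    have h := Real.add_one_le_exp (g ω + Y ω - Real.log 2)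
    rw [Real.exp_sub, Real.exp_log (by norm_num)] at h
    linarith
  have hmono := integral_mono (hg.add hY)
    ((hexp_int.div_const 2).add (integrable_const (Real.log 2 - 1))) hpt
  have hleft : ∫ ω, (g + Y) ω ∂A.prob E = L * (A.prob E).real B + ∫ ω, Y ω ∂A.prob E := by
    rw [integral_add' hg hY]
    simp only [g]
    rw [integral_indicator_const L hBm, smul_eq_mul, mul_comm]
  have hright : ∫ ω, (Real.exp (g ω + Y ω) / 2 + (Real.log 2 - 1)) ∂A.prob E =
      (∫ ω, Real.exp (g ω + Y ω) ∂A.prob E) / 2 + (Real.log 2 - 1) := by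
    rw [integral_add (hexp_int.div_const 2) (integrable_const _), integral_div]
    simp
  have hwald := A.neg_sum_le_integral_logLik E hm hi hκ hint hfin t
  have := hleft.symm.le.trans (hmono.trans hright.le)
  linarith

/-- An algorithm that returns `M` with high probability under `E` and with low probability under
`E'` has to collect enough information to tell the two environments apart; `κ e` is the relative
entropy between the reward distributions of `e`. -/
lemma log_le_sum_mul_expectedPulls (hm : ∀ e, Measurable (ℓ e))
    (hE : ∀ e, E'.law e = (E.law e).withDensity fun x => ENNReal.ofReal (Real.exp (ℓ e x)))
    (hi : ∀ e, Integrable (ℓ e) (E.law e)) (hκ : ∀ e, 0 ≤ κ e)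
    (hint : ∀ e, ∫ x, ℓ e x ∂E.law e = -κ e) (hfin : ∀ e, A.expectedPulls E e ≠ ∞)
    {δ : ℝ} (hδ : 0 < δ) (hδ1 : δ < 1) {M : Finset (Fin n)}
    (hM : ENNReal.ofReal (1 - δ) ≤ A.prob E {ω | A.Returns ω M})
    (hM' : A.prob E' {ω | A.Returns ω M} ≤ ENNReal.ofReal δ) :
    (1 - δ) * Real.log (1 / δ) ≤
      Real.log 2 + ∑ e, κ e * (A.expectedPulls E e).toReal := by
  set B : ℕ → Set (A.Seed × (ℕ → Fin n → ℝ)) :=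
    fun t => {ω | A.decision ω (A.cappedTime t ω) = some M} with hB
  have hmono : Monotone B := by
    intro t t' htt' ω hω
    obtain ⟨s, hs, h⟩ := (A.decision_cappedTime_eq_some).1 hω
    exact (A.decision_cappedTime_eq_some).2 ⟨s, hs.trans htt', h⟩
  have hU : ⋃ t, B t = {ω | A.Returns ω M} := by
    ext ω
    simp only [hB, Set.mem_iUnion, Set.mem_ofPred_eq, decision_cappedTime_eq_some, Returns]
    exact ⟨fun ⟨t, s, _, h⟩ => ⟨s, h⟩, fun ⟨s, h⟩ => ⟨s, s, le_rfl, h⟩⟩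
  have hlim := tendsto_measure_iUnion_atTop (μ := A.prob E) hmono
  rw [hU] at hlim
  have hlim' := ((ENNReal.tendsto_toReal (measure_ne_top _ _)).comp hlim).const_mul
    (Real.log (1 / δ))
  have hle := le_of_tendsto' hlim' fun t =>
    A.log_mul_measureReal_le E E' hm hE hi hκ hint hfin hδ hM' t
  have hp : 1 - δ ≤ (A.prob E {ω | A.Returns ω M}).toReal :=
    (ENNReal.ofReal_le_iff_le_toReal (measure_ne_top _ _)).1 hM
  have hL : 0 ≤ Real.log (1 / δ) := Real.log_nonneg (by rw [le_div_iff₀ hδ]; linarith)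
  nlinarith

end Information

/-- If the optimal super arms under `E` and `E'` differ, a `δ`-correct algorithm has to collect
information of order `log (1 / δ)`. -/
lemma IsCorrect.log_le_sum_mul_expectedPulls {A : Algorithm n} {δ : ℝ} (hA : A.IsCorrect P δ)
    (hδ : 0 < δ) (hδ1 : δ < 0.1) (E E' : Environment P) {M M' : Finset (Fin n)} (hne : M ≠ M')
    (hopt : IsUniqueOptimal P.superArms E.w M) (hopt' : IsUniqueOptimal P.superArms E'.w M')
    {ℓ : Fin n → ℝ → ℝ} {κ : Fin n → ℝ} (hm : ∀ e, Measurable (ℓ e))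
    (hE : ∀ e, E'.law e = (E.law e).withDensity fun x => ENNReal.ofReal (Real.exp (ℓ e x)))
    (hi : ∀ e, Integrable (ℓ e) (E.law e)) (hκ : ∀ e, 0 ≤ κ e)
    (hint : ∀ e, ∫ x, ℓ e x ∂E.law e = -κ e) (hfin : ∀ e, A.expectedPulls E e ≠ ∞) :
    Real.log (1 / δ) / 2 ≤ ∑ e, κ e * (A.expectedPulls E e).toReal := by
  have hM' : A.prob E' {ω | A.Returns ω M} ≤ ENNReal.ofReal δ := by
    calc A.prob E' {ω | A.Returns ω M} ≤ A.prob E' {ω | A.Returns ω M'}ᶜ :=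
          measure_mono fun ω h h' => hne (h.unique A h')
      _ = 1 - A.prob E' {ω | A.Returns ω M'} := prob_compl_eq_one_sub (A.measurableSet_returns M')
      _ ≤ 1 - ENNReal.ofReal (1 - δ) := tsub_le_tsub_left (hA E' M' hopt') 1
      _ = ENNReal.ofReal δ := by
          rw [← ENNReal.ofReal_one, ← ENNReal.ofReal_sub _ (by linarith)]
          congr 1
          ring
  have h := A.log_le_sum_mul_expectedPulls E E' hm hE hi hκ hint hfin hδ (by linarith)
    (hA E M hopt) hM'
  -- `2 ^ 5 ≤ 10 ^ 2`, so `log 2` is at most `0.4 * log 10`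
  have h10 : Real.log 10 ≤ Real.log (1 / δ) := by
    refine Real.log_le_log (by norm_num) ?_
    rw [le_div_iff₀ hδ]
    linarith
  have h2 : 5 * Real.log 2 ≤ 2 * Real.log 10 := by
    have := Real.log_le_log (x := 2 ^ 5) (y := 10 ^ 2) (by norm_num) (by norm_num)
    simpa [Real.log_pow] using this
  have hpos : 0 < Real.log 10 := Real.log_pos (by norm_num)
  nlinarith

end Algorithm

variable {n : ℕ}

/-! ### Gaussian environments -/

lemma hasSubgaussianMGF_gaussianReal (μ : ℝ) (v : ℝ≥0) :
    HasSubgaussianMGF (fun x : ℝ => x - ∫ y, y ∂(gaussianReal μ v)) v (gaussianReal μ v) := by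
  have hmap : (gaussianReal μ v).map (fun x => x - μ) = gaussianReal 0 v := by
    rw [gaussianReal_map_sub_const, sub_self]
  have hm : Measurable fun x : ℝ => x - μ := measurable_id.sub_const μ
  rw [integral_id_gaussianReal]
  constructor
  · intro t
    have h := integrable_exp_mul_gaussianReal (μ := 0) (v := v) t
    rw [← hmap] at h
    exact h.comp_measurable hm
  · intro t
    rw [mgf_gaussianReal hmap t]
    simp

/-- The environment in which the rewards of each base arm `e` are Gaussian with mean `v e` and
variance `R ^ 2`. -/
noncomputable def gaussianEnv (P : Problem n) (v : Fin n → ℝ) : Environment P where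
  law e := gaussianReal (v e) (P.R ^ 2)
  isProbabilityMeasure_law _ := inferInstance
  subGaussian e := hasSubgaussianMGF_gaussianReal (v e) (P.R ^ 2)

lemma gaussianEnv_law (P : Problem n) (v : Fin n → ℝ) (e : Fin n) :
    (gaussianEnv P v).law e = gaussianReal (v e) (P.R ^ 2) := rfl

lemma gaussianEnv_w (P : Problem n) (v : Fin n → ℝ) : (gaussianEnv P v).w = v := by
  funext e
  exact integral_id_gaussianReal

/-- The log-likelihood ratio between the Gaussian laws with means `μ'` and `μ` and variance `v`. -/
noncomputable def gaussianLogLik (μ μ' v x : ℝ) : ℝ :=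
  (μ' - μ) / v * (x - μ) - (μ' - μ) ^ 2 / (2 * v)

lemma measurable_gaussianLogLik (μ μ' v : ℝ) : Measurable (gaussianLogLik μ μ' v) := by
  unfold gaussianLogLik
  fun_prop

lemma gaussianReal_eq_withDensity_gaussianLogLik (μ μ' : ℝ) {v : ℝ≥0} (hv : v ≠ 0) :
    gaussianReal μ' v = (gaussianReal μ v).withDensity
      fun x => ENNReal.ofReal (Real.exp (gaussianLogLik μ μ' v x)) := by
  have hm : Measurable fun x => ENNReal.ofReal (Real.exp (gaussianLogLik μ μ' v x)) :=
    ENNReal.measurable_ofReal.comp (Real.measurable_exp.comp (measurable_gaussianLogLik μ μ' v))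
  rw [gaussianReal_of_var_ne_zero μ hv, gaussianReal_of_var_ne_zero μ' hv,
    ← withDensity_mul _ (measurable_gaussianPDF μ v) hm]
  congr 1
  funext x
  rw [Pi.mul_apply, gaussianPDF, gaussianPDF, ← ENNReal.ofReal_mul (gaussianPDFReal_nonneg μ v x),
    gaussianPDFReal, gaussianPDFReal, mul_assoc (√(2 * Real.pi * v))⁻¹, ← Real.exp_add]
  congr 3
  have hv' : (v : ℝ) ≠ 0 := by exact_mod_cast hv
  rw [gaussianLogLik]
  field_simp
  ring

lemma integrable_sub_gaussianReal (μ : ℝ) (v : ℝ≥0) :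
    Integrable (fun x => x - μ) (gaussianReal μ v) :=
  ((memLp_id_gaussianReal 1).integrable le_rfl).sub (integrable_const μ)

lemma integrable_gaussianLogLik (μ μ' : ℝ) (v : ℝ≥0) :
    Integrable (gaussianLogLik μ μ' v) (gaussianReal μ v) :=
  ((integrable_sub_gaussianReal μ v).const_mul _).sub (integrable_const _)

/-- The mean of the log-likelihood ratio is minus the relative entropy of the two Gaussian laws. -/
lemma integral_gaussianLogLik (μ μ' : ℝ) (v : ℝ≥0) :
    ∫ x, gaussianLogLik μ μ' v x ∂gaussianReal μ v = -((μ' - μ) ^ 2 / (2 * v)) := by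
  have h0 : ∫ x, (x - μ) ∂gaussianReal μ v = 0 := by
    have h := integral_sub ((memLp_id_gaussianReal (μ := μ) (v := v) 1).integrable le_rfl)
      (integrable_const μ)
    simp only [id_eq, integral_id_gaussianReal] at h
    simpa using h
  unfold gaussianLogLik
  rw [integral_sub ((integrable_sub_gaussianReal μ v).const_mul _) (integrable_const _),
    integral_const_mul, h0]
  simp

/-! ### Bottleneck values -/

lemma minW_le {M : Finset (Fin n)} {e : Fin n} (he : e ∈ M) (v : Fin n → ℝ) : minW M v ≤ v e := by
  rw [minW, dif_pos ⟨e, he⟩]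
  exact Finset.inf'_le v he

lemma exists_minW_eq {M : Finset (Fin n)} (hM : M.Nonempty) (v : Fin n → ℝ) :
    ∃ e ∈ M, minW M v = v e := by
  rw [minW, dif_pos hM]
  exact Finset.exists_mem_eq_inf' hM v

lemma le_minW {M : Finset (Fin n)} (hM : M.Nonempty) {v : Fin n → ℝ} {c : ℝ}
    (h : ∀ e ∈ M, c ≤ v e) : c ≤ minW M v := by
  obtain ⟨e, he, h'⟩ := exists_minW_eq hM v
  exact h' ▸ h e he

lemma minW_mono {M : Finset (Fin n)} (hM : M.Nonempty) {v v' : Fin n → ℝ}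
    (h : ∀ e ∈ M, v e ≤ v' e) : minW M v ≤ minW M v' :=
  le_minW hM fun e he => (minW_le he v).trans (h e he)

lemma minW_singleton (e : Fin n) (v : Fin n → ℝ) : minW {e} v = v e := by
  simp [minW]

lemma maxMinW_eq {F : Finset (Finset (Fin n))} {v : Fin n → ℝ} {M : Finset (Fin n)} (hM : M ∈ F)
    (h : ∀ M' ∈ F, minW M' v ≤ minW M v) : maxMinW F v = minW M v := by
  rw [maxMinW, dif_pos ⟨M, hM⟩]
  exact le_antisymm (Finset.sup'_le _ _ h) (Finset.le_sup' (fun M => minW M v) hM)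

/-! ### Richness of the family -/

/-- The instance with the super arms `S` and `{e}`, for `e ∈ B`, has prescribed gaps `g`: the means
are `g` on `S` and `g a - g` on `B`, where `a` is a minimizer of `g` on `S`. Then `OPT = g a`, and
the second best value is `0`, attained at the minimizer of `g` on `B`. -/
theorem exists_isHard_gap_eq (R : ℝ≥0) (S B : Finset (Fin n)) (g : Fin n → ℝ) (hR : 0 < R)
    (hd : Disjoint S B) (hg : ∀ e ∈ S ∪ B, 0 < g e)
    (hab : ∃ a ∈ S, ∃ b ∈ B, g a = g b ∧ (∀ e ∈ S, g a ≤ g e) ∧ (∀ e ∈ B, e ≠ b → g b < g e)) :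
    ∃ (P : Problem n) (E : Environment P),
      P.R = R ∧ IsHard E S ∧ necessary E.w S = B ∧
        ∀ e ∈ S ∪ B, gap P.superArms E.w S e = g e := by
  classical
  obtain ⟨a, ha, b, hb, hgab, hminS, hminB⟩ := hab
  have hSne : S.Nonempty := ⟨a, ha⟩
  have hgB (e) (he : e ∈ B) : 0 < g e := hg e (Finset.mem_union_right _ he)
  have hnS (e) (he : e ∈ B) : e ∉ S := fun h => Finset.disjoint_left.1 hd h he
  let P : Problem n :=
    { superArms := insert S (B.image fun e => {e})
      nonempty_of_mem := by
        intro M hM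
        rcases Finset.mem_insert.1 hM with rfl | hM
        · exact hSne
        · obtain ⟨e, -, rfl⟩ := Finset.mem_image.1 hM
          exact Finset.singleton_nonempty e
      R := R
      R_pos := hR }
  have hmem (M) : M ∈ P.superArms ↔ M = S ∨ ∃ e ∈ B, {e} = M := by
    simp [P]
  have hSmem : S ∈ P.superArms := (hmem S).2 (Or.inl rfl)
  have hBmem (e) (he : e ∈ B) : {e} ∈ P.superArms := (hmem _).2 (Or.inr ⟨e, he, rfl⟩)
  have hneS (e) (he : e ∈ B) : ({e} : Finset (Fin n)) ≠ S := fun h =>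
    hnS e he (h ▸ Finset.mem_singleton_self e)
  let w : Fin n → ℝ := fun e => if e ∈ S then g e else if e ∈ B then g a - g e else g a
  have hwS (e) (he : e ∈ S) : w e = g e := if_pos he
  have hwB (e) (he : e ∈ B) : w e = g a - g e := by simp [w, hnS e he, he]
  have hopt : minW S w = g a := by
    refine le_antisymm ((minW_le ha w).trans (hwS a ha).le) (le_minW hSne fun e he => ?_)
    rw [hwS e he]
    exact hminS e he
  have hlow (e) : w e < minW S w ↔ e ∈ B := by
    rw [hopt]
    refine ⟨fun h => ?_, fun h => ?_⟩
    · by_contra hB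
      by_cases hS : e ∈ S
      · exact absurd (hminS e hS) (by rw [hwS e hS] at h; linarith)
      · simp [w, hS, hB] at h
    · rw [hwB e h]
      linarith [hgB e h]
  have hwb : w b = 0 := by rw [hwB b hb, hgab, sub_self]
  refine ⟨P, gaussianEnv P w, rfl, ?_⟩
  have hnec : necessary w S = B := by
    ext e
    simp only [necessary, Finset.mem_filter, Finset.mem_univ, true_and, hlow]
    exact ⟨fun h => h.2, fun h => ⟨hnS e h, h⟩⟩
  rw [gaussianEnv_w]
  refine ⟨?_, hnec, ?_⟩
  · constructor
    · intro e
      rw [gaussianEnv_w, gaussianEnv_law]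
    · rw [gaussianEnv_w]
      refine ⟨hSmem, fun M hM hne => ?_⟩
      obtain rfl | ⟨e, he, rfl⟩ := (hmem M).1 hM
      · exact absurd rfl hne
      · rw [minW_singleton]
        exact (hlow e).2 he
    · rw [gaussianEnv_w]
      refine ⟨{b}, hBmem b hb, by simpa using hnS b hb, fun M hM hne hneb => ?_⟩
      obtain rfl | ⟨e, he, rfl⟩ := (hmem M).1 hM
      · exact absurd rfl hne
      · rw [minW_singleton, minW_singleton, hwB e he, hwB b hb]
        have := hminB e he fun h => hneb (by rw [h])
        linarith
    · rw [gaussianEnv_w]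
      intro M hM hne
      obtain rfl | ⟨e, he, rfl⟩ := (hmem M).1 hM
      · exact absurd rfl hne
      · exact ⟨e, ⟨Finset.mem_singleton_self e, (hlow e).2 he⟩,
          fun e' h => Finset.mem_singleton.1 h.1⟩
    · rw [gaussianEnv_w, hnec]
      refine fun e he => ⟨{e}, ⟨hBmem e he, Finset.mem_singleton_self e⟩, fun M ⟨hM, heM⟩ => ?_⟩
      obtain rfl | ⟨e', he', rfl⟩ := (hmem M).1 hM
      · exact absurd heM (hnS e he)
      · rw [Finset.mem_singleton.1 heM]
    · rw [gaussianEnv_w]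
      intro M hM hne e he heS
      obtain rfl | ⟨e', he', rfl⟩ := (hmem M).1 hM
      · exact absurd rfl hne
      · exact absurd heS (hnS e (Finset.mem_singleton.1 he ▸ he'))
  · intro e he
    by_cases heS : e ∈ S
    · have : maxMinW (P.superArms.filter fun M => M ≠ S) w = minW {b} w := by
        refine maxMinW_eq (Finset.mem_filter.2 ⟨hBmem b hb, hneS b hb⟩) fun M hM => ?_
        obtain ⟨hM, hne⟩ := Finset.mem_filter.1 hM
        obtain rfl | ⟨e', he', rfl⟩ := (hmem M).1 hM
        · exact absurd rfl hne
        · rw [minW_singleton, minW_singleton, hwB e' he', hwB b hb]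
          by_cases h : e' = b
          · rw [h]
          · linarith [hminB e' he' h]
      rw [gap, if_pos heS, this, minW_singleton, hwb, hwS e heS, sub_zero]
    · have heB : e ∈ B := (Finset.mem_union.1 he).resolve_left heS
      have : maxMinW (P.superArms.filter fun M => e ∈ M) w = minW {e} w := by
        refine maxMinW_eq (Finset.mem_filter.2 ⟨hBmem e heB, Finset.mem_singleton_self e⟩)
          fun M hM => ?_
        obtain ⟨hM, heM⟩ := Finset.mem_filter.1 hM
        obtain rfl | ⟨e', he', rfl⟩ := (hmem M).1 hM
        · exact absurd heM heS
        · rw [Finset.mem_singleton.1 heM]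
      rw [gap, if_neg heS, if_neg (not_le.2 ((hlow e).2 heB)), this, minW_singleton, hopt,
        hwB e heB]
      ring

/-! ### Perturbations of a hard instance -/

section LowerBound

variable {P : Problem n} {E : Environment P} {Ms : Finset (Fin n)} {A : Algorithm n} {δ : ℝ}

/-- The information inequality for a Gaussian environment: `v` is any reward vector with another
optimal super arm. -/
lemma IsHard.log_le_sum_sq_mul_expectedPulls (h : IsHard E Ms) (hA : A.IsCorrect P δ) (hδ : 0 < δ)
    (hδ1 : δ < 0.1) (hfin : ∀ e, A.expectedPulls E e ≠ ∞) {v : Fin n → ℝ} {M : Finset (Fin n)}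
    (hne : Ms ≠ M) (hM : IsUniqueOptimal P.superArms v M) :
    (P.R : ℝ) ^ 2 * Real.log (1 / δ) ≤ ∑ e, (v e - E.w e) ^ 2 * (A.expectedPulls E e).toReal := by
  have hR : (0 : ℝ) < P.R := P.R_pos
  have key := hA.log_le_sum_mul_expectedPulls hδ hδ1 E (gaussianEnv P v) hne h.optimal
    (by rwa [gaussianEnv_w]) (ℓ := fun e => gaussianLogLik (E.w e) (v e) (P.R ^ 2 : ℝ≥0))
    (κ := fun e => (v e - E.w e) ^ 2 / (2 * (P.R ^ 2 : ℝ≥0)))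
    (fun e => measurable_gaussianLogLik _ _ _)
    (fun e => by
      rw [h.gaussian e, gaussianEnv_law]
      exact gaussianReal_eq_withDensity_gaussianLogLik _ _ (pow_pos P.R_pos 2).ne')
    (fun e => by rw [h.gaussian e]; exact integrable_gaussianLogLik _ _ _)
    (fun e => by positivity)
    (fun e => by
      rw [h.gaussian e]
      exact integral_gaussianLogLik _ _ _) hfin
  simp_rw [div_mul_eq_mul_div] at key
  rw [← Finset.sum_div, NNReal.coe_pow, div_le_div_iff₀ (by norm_num) (by positivity)] at key
  linarith

/-- A base arm of the optimal super arm is played often: lowering its mean by twice its gap makes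
the second best super arm optimal. -/
lemma IsHard.le_expectedPulls_of_mem (h : IsHard E Ms) (hA : A.IsCorrect P δ) (hδ : 0 < δ)
    (hδ1 : δ < 0.1) (hfin : ∀ e, A.expectedPulls E e ≠ ∞) {e : Fin n} (he : e ∈ Ms) :
    0 < gap P.superArms E.w Ms e ∧ (P.R : ℝ) ^ 2 * Real.log (1 / δ) ≤
      4 * gap P.superArms E.w Ms e ^ 2 * (A.expectedPulls E e).toReal := by
  obtain ⟨M₂, hM₂, hdisj, hsec⟩ := h.second
  have hne : Ms ≠ M₂ := by
    rintro rfl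
    exact Finset.disjoint_left.1 hdisj he he
  have hlt := h.optimal.2 M₂ hM₂ hne.symm
  have hgap : gap P.superArms E.w Ms e = E.w e - minW M₂ E.w := by
    rw [gap, if_pos he, maxMinW_eq (M := M₂)]
    · exact Finset.mem_filter.2 ⟨hM₂, hne.symm⟩
    · intro M hM
      obtain ⟨hM, hMs⟩ := Finset.mem_filter.1 hM
      by_cases hMM : M = M₂
      · rw [hMM]
      · exact (hsec M hM hMs hMM).le
  have hpos : 0 < gap P.superArms E.w Ms e := by
    rw [hgap]
    linarith [minW_le he E.w]
  refine ⟨hpos, ?_⟩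
  set Δ := gap P.superArms E.w Ms e with hΔ
  set v : Fin n → ℝ := Function.update E.w e (E.w e - 2 * Δ) with hv
  have hve : v e = E.w e - 2 * Δ := Function.update_self ..
  have hvne {x : Fin n} (hx : x ≠ e) : v x = E.w x := Function.update_of_ne hx ..
  have hvle (x : Fin n) : v x ≤ E.w x := by
    by_cases hx : x = e
    · rw [hx, hve]; linarith
    · exact (hvne hx).le
  have hv2 : minW M₂ E.w ≤ minW M₂ v := by
    refine minW_mono (P.nonempty_of_mem _ hM₂) fun x hx => (hvne ?_).ge
    rintro rfl
    exact Finset.disjoint_left.1 hdisj hx he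
  have hopt : IsUniqueOptimal P.superArms v M₂ := by
    refine ⟨hM₂, fun M hM hMM => lt_of_lt_of_le ?_ hv2⟩
    by_cases hMs : M = Ms
    · rw [hMs]
      refine (minW_le he v).trans_lt ?_
      rw [hve]
      linarith
    · exact (minW_mono (P.nonempty_of_mem _ hM) fun x _ => hvle x).trans_lt (hsec M hM hMs hMM)
  refine (h.log_le_sum_sq_mul_expectedPulls hA hδ hδ1 hfin hne hopt).trans_eq ?_
  rw [Finset.sum_eq_single e]
  · rw [hve]; ring
  · intro x _ hx
    rw [hvne hx]; ring
  · simp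

/-- A base arm of `N` is played often: raising its mean to `OPT`, and lowering the bottlenecks of
the optimal super arm slightly, makes the super arm that owns it optimal. Lowering the bottlenecks
avoids a tie, which other base arms with mean `OPT` would cause however high the mean is raised; its
cost vanishes in the limit. -/
lemma IsHard.le_expectedPulls_of_mem_necessary (h : IsHard E Ms) (hA : A.IsCorrect P δ)
    (hδ : 0 < δ) (hδ1 : δ < 0.1) (hfin : ∀ e, A.expectedPulls E e ≠ ∞) {e : Fin n}
    (he : e ∈ necessary E.w Ms) :
    0 < gap P.superArms E.w Ms e ∧ (P.R : ℝ) ^ 2 * Real.log (1 / δ) ≤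
      gap P.superArms E.w Ms e ^ 2 * (A.expectedPulls E e).toReal := by
  classical
  obtain ⟨Me, ⟨hMe, heM⟩, huniq⟩ := h.owner e he
  have mem_nec {x : Fin n} : x ∈ necessary E.w Ms ↔ x ∉ Ms ∧ E.w x < minW Ms E.w := by
    simp [necessary]
  obtain ⟨heMs, hlt⟩ := mem_nec.1 he
  have hne : Ms ≠ Me := fun h => heMs (h ▸ heM)
  have hlarge {x : Fin n} (hx : x ∈ Me) (hxe : x ≠ e) : minW Ms E.w ≤ E.w x :=
    not_lt.1 fun hlt' => hxe ((h.single Me hMe hne.symm).unique ⟨hx, hlt'⟩ ⟨heM, hlt⟩)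
  have hgap : gap P.superArms E.w Ms e = minW Ms E.w - E.w e := by
    rw [gap, if_neg heMs, if_neg (not_le.2 hlt), maxMinW_eq (M := Me)]
    · congr 1
      refine le_antisymm (minW_le heM _) (le_minW ⟨e, heM⟩ fun x hx => ?_)
      by_cases hxe : x = e
      · rw [hxe]
      · exact hlt.le.trans (hlarge hx hxe)
    · exact Finset.mem_filter.2 ⟨hMe, heM⟩
    · intro M hM
      rw [huniq M (Finset.mem_filter.1 hM)]
  refine ⟨by rw [hgap]; linarith, ?_⟩
  set Δ := gap P.superArms E.w Ms e with hΔ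
  set T : Fin n → ℝ := fun x => (A.expectedPulls E x).toReal with hT
  have hbound (ε : ℝ) (hε : 0 < ε) :
      (P.R : ℝ) ^ 2 * Real.log (1 / δ) ≤ Δ ^ 2 * T e + ε ^ 2 * ∑ x, T x := by
    set v : Fin n → ℝ := fun x => if x = e then minW Ms E.w else
      if x ∈ Ms ∧ E.w x = minW Ms E.w then E.w x - ε else E.w x with hv
    have hve : v e = minW Ms E.w := if_pos rfl
    have hvMe {x : Fin n} (hx : x ∈ Me) : minW Ms E.w ≤ v x := by
      by_cases hxe : x = e
      · rw [hxe, hve]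
      · have : ¬ (x ∈ Ms ∧ E.w x = minW Ms E.w) := fun hxs =>
          (h.bottleneck Me hMe hne.symm x hx hxs.1).ne' hxs.2
        simp only [hv, if_neg hxe, if_neg this]
        exact hlarge hx hxe
    have hopt : IsUniqueOptimal P.superArms v Me := by
      refine ⟨hMe, fun M hM hMM => lt_of_lt_of_le ?_ (le_minW ⟨e, heM⟩ fun x hx => hvMe hx)⟩
      by_cases hMs : M = Ms
      · rw [hMs]
        obtain ⟨x, hx, hxw⟩ := exists_minW_eq (P.nonempty_of_mem _ h.optimal.1) E.w
        refine (minW_le hx v).trans_lt ?_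
        have hxe : x ≠ e := fun h => heMs (h ▸ hx)
        simp only [hv, if_neg hxe, if_pos (And.intro hx hxw.symm)]
        linarith
      · obtain ⟨x, ⟨hx, hxw⟩, -⟩ := h.single M hM hMs
        have hxs : x ∉ Ms := fun hxs => absurd (minW_le hxs E.w) (not_le.2 hxw)
        have hxe : x ≠ e := fun h => hMM (huniq M ⟨hM, h ▸ hx⟩)
        refine (minW_le hx v).trans_lt ?_
        simpa [hv, hxe, hxs] using hxw
    refine (h.log_le_sum_sq_mul_expectedPulls hA hδ hδ1 hfin hne hopt).trans ?_
    have hterm (x : Fin n) : (v x - E.w x) ^ 2 * T x ≤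
        (if x = e then Δ ^ 2 * T e else 0) + ε ^ 2 * T x := by
      have hTx : 0 ≤ T x := ENNReal.toReal_nonneg
      by_cases hxe : x = e
      · rw [if_pos hxe, hxe, hve, hgap]
        rw [hxe] at hTx
        have := mul_nonneg (sq_nonneg ε) hTx
        linarith
      · rw [if_neg hxe, zero_add]
        refine mul_le_mul_of_nonneg_right ?_ hTx
        simp only [hv, if_neg hxe]
        split_ifs
        · exact (by ring : (E.w x - ε - E.w x) ^ 2 = ε ^ 2).le
        · simpa using sq_nonneg ε
    refine (Finset.sum_le_sum fun x _ => hterm x).trans_eq ?_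
    rw [Finset.sum_add_distrib, Finset.sum_ite_eq', if_pos (Finset.mem_univ e), Finset.mul_sum]
  have hcont : Continuous fun ε : ℝ => Δ ^ 2 * T e + ε ^ 2 * ∑ x, T x := by fun_prop
  have hlim := (hcont.tendsto 0).mono_left (nhdsWithin_le_nhds (s := Set.Ioi 0))
  have := ge_of_tendsto hlim (Filter.eventually_of_mem self_mem_nhdsWithin hbound)
  simpa using this

/-- The lower bound of the family, with `c = 1 / 4`. The expected number of samples is finite
without loss of generality, which the real-valued bounds on the expected numbers of plays need. -/
theorem IsHard.le_expectedSamples (h : IsHard E Ms) (hA : A.IsCorrect P δ) (hδ : 0 < δ)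
    (hδ1 : δ < 0.1) :
    ENNReal.ofReal (1 / 4 * ∑ e ∈ Ms ∪ necessary E.w Ms,
      (P.R : ℝ) ^ 2 / gap P.superArms E.w Ms e ^ 2 * Real.log (1 / δ)) ≤ A.expectedSamples E := by
  have hsum := A.sum_expectedPulls_le E
  by_cases htop : A.expectedSamples E = ∞
  · rw [htop]; exact le_top
  have hfin (e) : A.expectedPulls E e ≠ ∞ := ne_top_of_le_ne_top htop
    ((Finset.single_le_sum (f := fun e => A.expectedPulls E e) (fun _ _ => zero_le)
      (Finset.mem_univ e)).trans hsum)
  have hterm : ∀ e ∈ Ms ∪ necessary E.w Ms,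
      1 / 4 * ((P.R : ℝ) ^ 2 / gap P.superArms E.w Ms e ^ 2 * Real.log (1 / δ)) ≤
        (A.expectedPulls E e).toReal := by
    intro e he
    have h0 : 0 ≤ gap P.superArms E.w Ms e ^ 2 * (A.expectedPulls E e).toReal := by positivity
    obtain ⟨hpos, hle⟩ : 0 < gap P.superArms E.w Ms e ∧ (P.R : ℝ) ^ 2 * Real.log (1 / δ) ≤
        4 * gap P.superArms E.w Ms e ^ 2 * (A.expectedPulls E e).toReal := by
      rcases Finset.mem_union.1 he with he | he
      · exact h.le_expectedPulls_of_mem hA hδ hδ1 hfin he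
      · obtain ⟨h1, h2⟩ := h.le_expectedPulls_of_mem_necessary hA hδ hδ1 hfin he
        exact ⟨h1, by linarith⟩
    have : 1 / 4 * ((P.R : ℝ) ^ 2 / gap P.superArms E.w Ms e ^ 2 * Real.log (1 / δ)) =
        (P.R : ℝ) ^ 2 * Real.log (1 / δ) / (4 * gap P.superArms E.w Ms e ^ 2) := by
      field_simp
    rw [this, div_le_iff₀ (by positivity)]
    linarith
  refine le_trans ?_ hsum
  rw [← ENNReal.ofReal_toReal (ENNReal.sum_ne_top.2 fun e _ => hfin e),
    ENNReal.toReal_sum fun e _ => hfin e, Finset.mul_sum]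
  refine ENNReal.ofReal_le_ofReal ((Finset.sum_le_sum hterm).trans ?_)
  exact Finset.sum_le_sum_of_subset_of_nonneg (Finset.subset_univ _)
    fun e _ _ => ENNReal.toReal_nonneg

end LowerBound
end CPEB

theorem theorem3 :
    (∀ (n : ℕ) (R : ℝ≥0) (S B : Finset (Fin n)) (g : Fin n → ℝ),
      0 < R → Disjoint S B → (∀ e ∈ S ∪ B, 0 < g e) →
      (∃ a ∈ S, ∃ b ∈ B, g a = g b ∧ (∀ e ∈ S, g a ≤ g e) ∧ (∀ e ∈ B, e ≠ b → g b < g e)) →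
      ∃ (P : CPEB.Problem n) (E : CPEB.Environment P),
        P.R = R ∧ CPEB.IsHard E S ∧ CPEB.necessary E.w S = B ∧
          ∀ e ∈ S ∪ B, CPEB.gap P.superArms E.w S e = g e) ∧
    ∃ c : ℝ, 0 < c ∧
      ∀ (n : ℕ) (P : CPEB.Problem n) (E : CPEB.Environment P) (Ms : Finset (Fin n)),
        CPEB.IsHard E Ms →
        ∀ δ : ℝ, 0 < δ → δ < 0.1 →
        ∀ A : CPEB.Algorithm n, A.IsCorrect P δ →
          ENNReal.ofReal
              (c * ∑ e ∈ Ms ∪ CPEB.necessary E.w Ms,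
                (P.R : ℝ) ^ 2 / (CPEB.gap P.superArms E.w Ms e) ^ 2 * Real.log (1 / δ))
            ≤ A.expectedSamples E :=
  ⟨fun _ R S B g hR hd hg hab => CPEB.exists_isHard_gap_eq R S B g hR hd hg hab,
    1 / 4, by norm_num, fun _ _ _ _ h _ hδ hδ1 _ hA => h.le_expectedSamples hA hδ hδ1⟩
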